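/- Let $d,n,m\ge 0$ be integers, let $\beta=\beta^{(2n)}=\{\beta_{\mathbf i}\}_{\mathbf i\in\mathbb Z_+^d,\,|\mathbf i|\le 2n}$ be a real truncated multisequence, and let $\mathcal Q=\{q_1,\dots,q_m\}\subset\mathbb R[t_1,\dots,t_d]$ and $K_{\mathcal Q}=\{t\in\mathbb R^d: q_i(t)\ge 0,\ 1\le i\le m\}$. A representing measure for a (truncated) multisequence is a positive Borel measure $\mu$ on $\mathbb R^d$ for which all monomials $x^{\mathbf i}$ occurring are integrable and $\int x^{\mathbf i}\,d\mu=\beta_{\mathbf i}$; it is $r$-atomic if $\mu=\sum_{l=1}^r c_l\delta_{x_l}$ with $c_l>0$ and distinct $x_l$. Let $M(k)=(\beta_{\mathbf i+\mathbf j})_{|\mathbf i|,|\mathbf j|\le k}$ denote the moment matrix of a multisequence of degree $2k$. A flat extension $M(n+1)$ of $M(n)$ is the moment matrix of a multisequence $\beta^{(2n+2)}$ extending $\beta^{(2n)}$ such that $\operatorname{rank}M(n+1)=\operatorname{rank}M(n)$. If $M(n)\ge 0$ and $M(n+1)$ is a flat extension of $M(n)$, then $\beta^{(2n+2)}$ has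 a unique extension to a full multisequence $\hat\beta=\{\hat\beta_{\mathbf i}\}_{\mathbf i\in\mathbb Z_+^d}$ whose moment matrices satisfy $\operatorname{rank}M(k)=\operatorname{rank}M(n+1)$ for all $k\ge n+1$. For a polynomial $q=\sum_\gamma q_\gamma t^\gamma$ the localizing matrix determined by $M(n+1)$ is then $$M_q\left(n+\left[\tfrac{\deg q+1}{2}\right]\right)=\Big(\sum_\gamma q_\gamma\hat\beta_{\gamma+\mathbf i+\mathbf j}\Big)_{|\mathbf i|,|\mathbf j|\le n}.$$ **Theorem.** $\beta^{(2n)}$ admits a $\operatorname{rank}M(n)$-atomic representing measure supported in $K_{\mathcal Q}$ if and only if $M(n)\ge 0$ and $M(n)$ admits a flat extension $M(n+1)$ such that $M_{q_i}\left(n+\left[\frac{\deg q_i+1}{2}\right]\right)\ge 0$ for $1\le i\le m$. In this case, for every such flat extension, $M(n+1)$ (that is, $\beta^{(2n+2)}$) admits a unique representing measure $\mu$. This $\mu$ is a $\operatorname{rank}M(n)$-atomic representing measure for $\beta^{(2n)}$ supported in $K_{\mathcal Q}$, and it is minimal: every finitely atomic representing measure for $\beta^{(2n)}$ has at least $\operatorname{rank}M(n)$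 atoms. Moreover, for $1\le i\le m$, $\mu$ has exactly $\operatorname{rank}M(n)-\operatorname{rank}M_{q_i}\left(n+\left[\frac{\deg q_i+1}{2}\right]\right)$ atoms in $\mathcal Z(q_i)=\{t\in\mathbb R^d:q_i(t)=0\}$. -/

import Mathlib

open MeasureTheory
open scoped NNReal

namespace TruncatedMoment

/-- Multi-indices in `d` variables; `i.degree` is the sum of the components of `i`. -/
abbrev MultiIndex (d : ℕ) := Fin d →₀ ℕ

/-- Multi-indices of total degree at most `N`; these label the monomials of degree at most `N`. -/
abbrev TruncIndex (d N : ℕ) := {i : MultiIndex d // i.degree ≤ N}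

noncomputable instance instFintypeTruncIndex (d N : ℕ) : Fintype (TruncIndex d N) :=
  have : Finite (TruncIndex d N) := (Finsupp.finite_of_degree_le N).to_subtype
  Fintype.ofFinite _

/-- Real multisequences indexed by all multi-indices. -/
abbrev FullSeq (d : ℕ) := MultiIndex d → ℝ

/-- Real truncated multisequences, indexed by the multi-indices of degree at most `N`. -/
abbrev TruncSeq (d N : ℕ) := TruncIndex d N → ℝ

/-- The truncation of a full multisequence to the multi-indices of degree at most `N`. -/
def truncate {d : ℕ} (N : ℕ) (β : FullSeq d) : TruncSeq d N := fun i => β i.1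

/-- The moment matrix `M(n)` of a multisequence of degree `2 n`: the entry in row `i` and column
`j`, where `i` and `j` have degree at most `n`, is `β (i + j)`. -/
noncomputable def momentMatrix {d : ℕ} (n : ℕ) (β : TruncSeq d (2 * n)) :
    Matrix (TruncIndex d n) (TruncIndex d n) ℝ :=
  fun i j => β ⟨i.1 + j.1, by
    have hi := i.2
    have hj := j.2
    rw [map_add]
    omega⟩

/-- The multisequence `q * β` with entries `(q * β) α = ∑ γ, q_γ β (γ + α)`. -/
noncomputable def polyShift {d : ℕ} (q : MvPolynomial (Fin d) ℝ) (β : FullSeq d) : FullSeq d :=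
  fun α => ∑ γ ∈ q.support, q.coeff γ * β (γ + α)

/-- The localizing matrix `M_q(n + [(deg q + 1) / 2])` of `β`, which by definition is the moment
matrix `M(n)` of `q * β`. Its entries involve `β` only in degrees at most `2 n + deg q`,
hence at most `2 (n + [(deg q + 1) / 2])`. -/
noncomputable def localizingMatrix {d : ℕ} (n : ℕ) (q : MvPolynomial (Fin d) ℝ) (β : FullSeq d) :
    Matrix (TruncIndex d n) (TruncIndex d n) ℝ :=
  momentMatrix n (truncate (2 * n) (polyShift q β))

/-- `M(n + 1)(β')` is a flat (that is, rank-preserving) extension of `M(n)(β)`. -/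
def IsFlatExtension {d : ℕ} (n : ℕ) (β : TruncSeq d (2 * n)) (β' : TruncSeq d (2 * (n + 1))) :
    Prop :=
  (∀ i : TruncIndex d (2 * n), β' ⟨i.1, i.2.trans (by omega)⟩ = β i) ∧
    (momentMatrix (n + 1) β').rank = (momentMatrix n β).rank

/-- `γ` extends `β'` to all degrees through successive flat extensions
`M(n + 2), M(n + 3), …` of `M(n + 1)(β')`. -/
def IsFlatCompletion {d : ℕ} (n : ℕ) (β' : TruncSeq d (2 * (n + 1))) (γ : FullSeq d) : Prop :=
  truncate (2 * (n + 1)) γ = β' ∧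
    ∀ k, n + 1 ≤ k →
      (momentMatrix k (truncate (2 * k) γ)).rank = (momentMatrix (n + 1) β').rank

/-- The positive Borel measure `μ` on `ℝ^d` is a representing measure for `β`. -/
def Represents {d N : ℕ} (μ : Measure (Fin d → ℝ)) (β : TruncSeq d N) : Prop :=
  ∀ i : TruncIndex d N,
    Integrable (fun x : Fin d → ℝ => ∏ l, x l ^ i.1 l) μ ∧
      ∫ x, ∏ l, x l ^ i.1 l ∂μ = β i

/-- `μ` is `r`-atomic: a sum of point masses, with positive weights, at `r` distinct points. -/
def IsAtomicOfCard {d : ℕ} (r : ℕ) (μ : Measure (Fin d → ℝ)) : Prop :=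
  ∃ (s : Finset (Fin d → ℝ)) (c : (Fin d → ℝ) → ℝ≥0),
    s.card = r ∧ (∀ x ∈ s, 0 < c x) ∧ μ = ∑ x ∈ s, c x • Measure.dirac x

/-- The closed semialgebraic set of the points where all `q i` are nonnegative. -/
def semialgebraicSet {d m : ℕ} (q : Fin m → MvPolynomial (Fin d) ℝ) : Set (Fin d → ℝ) :=
  {x | ∀ i, 0 ≤ MvPolynomial.eval x (q i)}

/-- The real zero set of `q`. -/
def zeroSet {d : ℕ} (q : MvPolynomial (Fin d) ℝ) : Set (Fin d → ℝ) :=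
  {x | MvPolynomial.eval x q = 0}

/-- The set of atoms of `μ`. -/
def atoms {d : ℕ} (μ : Measure (Fin d → ℝ)) : Set (Fin d → ℝ) :=
  {x | μ {x} ≠ 0}

end TruncatedMoment

/-! A flat extension is realized by operators. `M(n + 1)` is the Gram matrix of vectors `v i`, and
flatness says that those of degree at most `n` already span. Since entries depend only on `i + j`,
multiplication by each variable acts on this span as a well-defined symmetric operator, and these
operators commute. Splitting `v 0` into joint eigenvectors `e x` gives `v i = ∑ x ^ i • e x`: the
atoms are the joint eigenvalues and the weights are `‖e x‖ ^ 2`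
(`exists_atomicMoments_of_isFlatExtension`).

The rest follows from the factorization `W D Wᵀ`, with `W` the matrix of monomial values at the
atoms. With `rank M(n)` atoms, `W` has a left inverse already in degree `n`, so positivity and rank
can be read off `D`. For a localizing matrix the entries of `D` are `c x * q x`, so their signs
locate the support and their zeros count the atoms in the zero set. The same left inverse supplies
interpolating polynomials, which force uniqueness of the measure (`Represents.eq_sum_dirac`) and
then of the flat completion. Conversely, at every level the rank for an atomic measure is at most
its number of atoms. -/

open scoped Matrix InnerProductSpace

/-! ### Rank and positivity of real matrices -/

namespace Matrix

variable {ι κ : Type*} [Fintype ι] [Fintype κ]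

/-- A real matrix of full column rank has a left inverse. -/
theorem exists_mul_eq_one_of_card_le_rank [DecidableEq κ] (A : Matrix ι κ ℝ)
    (h : Fintype.card κ ≤ A.rank) : ∃ B : Matrix κ ι ℝ, B * A = 1 := by
  have hr : (Aᵀ * A).rank = Fintype.card κ := by
    rw [rank_transpose_mul_self]
    exact le_antisymm A.rank_le_card_width h
  have hs : Function.Surjective (Aᵀ * A).mulVec := by
    rw [← coe_mulVecLin, ← LinearMap.range_eq_top]
    apply Submodule.eq_top_of_finrank_eq
    rw [Module.finrank_fintype_fun_eq_card]
    exact hr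
  obtain ⟨u, hu⟩ := mulVec_surjective_iff_isUnit.1 hs
  exact ⟨(↑u⁻¹ : Matrix κ κ ℝ) * Aᵀ, by rw [Matrix.mul_assoc, ← hu, Units.inv_mul]⟩

/-- If a symmetric matrix has the same rank as one of its principal submatrices, then the
corresponding columns generate all columns. -/
theorem exists_submatrix_mul_eq_of_rank_eq (M : Matrix κ κ ℝ) (e : ι → κ)
    (h : M.rank = (M.submatrix e e).rank) :
    ∃ Y : Matrix ι κ ℝ, M.submatrix id e * Y = M := by
  classical
  have hle : LinearMap.range (M.submatrix id e).mulVecLin ≤ LinearMap.range M.mulVecLin := by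
    rw [range_mulVecLin, range_mulVecLin]
    apply Submodule.span_mono
    rintro _ ⟨i, rfl⟩
    exact ⟨e i, rfl⟩
  -- Deleting rows cannot raise the rank, so the selected columns have rank at least that of the
  -- principal submatrix, which is the rank of `M`.
  have heq : LinearMap.range (M.submatrix id e).mulVecLin = LinearMap.range M.mulVecLin := by
    apply Submodule.eq_of_le_of_finrank_le hle
    change M.rank ≤ (M.submatrix id e).rank
    rw [h]
    exact rank_submatrix_le (M.submatrix id e) e (Equiv.refl ι)
  have hcol : ∀ j : κ, ∃ y : ι → ℝ, M.submatrix id e *ᵥ y = M.col j := by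
    intro j
    have : M.col j ∈ LinearMap.range (M.submatrix id e).mulVecLin := by
      rw [heq, range_mulVecLin]
      exact Submodule.subset_span ⟨j, rfl⟩
    exact this
  choose y hy using hcol
  refine ⟨(Matrix.of y)ᵀ, ?_⟩
  ext i j
  exact congrFun (hy j) i

/-- A symmetric matrix with a positive semidefinite principal submatrix of the same rank is
positive semidefinite. -/
theorem PosSemidef.of_submatrix_of_rank_eq {M : Matrix κ κ ℝ} (hM : Mᵀ = M) {e : ι → κ}
    (hA : (M.submatrix e e).PosSemidef) (h : M.rank = (M.submatrix e e).rank) :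
    M.PosSemidef := by
  obtain ⟨Y, hY⟩ := exists_submatrix_mul_eq_of_rank_eq M e h
  have h1 : M.submatrix e id = M.submatrix e e * Y := by
    conv_lhs => rw [← hY]
    rfl
  have h2 : M.submatrix id e = Yᵀ * M.submatrix e e := by
    have := congrArg Matrix.transpose h1
    rwa [transpose_mul, transpose_submatrix, transpose_submatrix, hM] at this
  have h3 : M = Yᴴ * M.submatrix e e * Y := by
    rw [conjTranspose_eq_transpose_of_trivial, ← h2, hY]
  rw [h3]
  exact hA.conjTranspose_mul_mul_same Y

section LeftInverse

variable [DecidableEq κ]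

theorem rank_mul_diagonal_mul_transpose {W : Matrix ι κ ℝ} {B : Matrix κ ι ℝ} (h : B * W = 1)
    (w : κ → ℝ) : (W * diagonal w * Wᵀ).rank = (diagonal w).rank := by
  apply le_antisymm
  · exact (rank_mul_le_left _ _).trans (rank_mul_le_right _ _)
  · have h' : Wᵀ * Bᵀ = 1 := by rw [← transpose_mul, h, transpose_one]
    have : diagonal w = B * (W * diagonal w * Wᵀ) * Bᵀ := by
      rw [Matrix.mul_assoc, Matrix.mul_assoc (W * diagonal w), h', Matrix.mul_one,
        ← Matrix.mul_assoc, h, Matrix.one_mul]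
    conv_lhs => rw [this]
    exact (rank_mul_le_left _ _).trans (rank_mul_le_right _ _)

theorem posSemidef_mul_diagonal_mul_transpose {W : Matrix ι κ ℝ} {w : κ → ℝ} (hw : 0 ≤ w) :
    (W * diagonal w * Wᵀ).PosSemidef := by
  rw [← conjTranspose_eq_transpose_of_trivial]
  exact (PosSemidef.diagonal hw).mul_mul_conjTranspose_same W

theorem nonneg_of_posSemidef_mul_diagonal_mul_transpose {W : Matrix ι κ ℝ} {B : Matrix κ ι ℝ}
    (h : B * W = 1) {w : κ → ℝ} (hp : (W * diagonal w * Wᵀ).PosSemidef) : 0 ≤ w := by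
  have h' : Wᵀ * Bᵀ = 1 := by rw [← transpose_mul, h, transpose_one]
  have : diagonal w = B * (W * diagonal w * Wᵀ) * Bᴴ := by
    rw [conjTranspose_eq_transpose_of_trivial, Matrix.mul_assoc,
      Matrix.mul_assoc (W * diagonal w), h', Matrix.mul_one,
      ← Matrix.mul_assoc, h, Matrix.one_mul]
  have h2 := hp.mul_mul_conjTranspose_same B
  rw [← this, posSemidef_diagonal_iff] at h2
  exact h2

end LeftInverse

end Matrix

/-! ### Moments of atomic measures and interpolation -/

namespace TruncatedMoment

variable {d : ℕ}

/-- The monomial function `x ↦ x ^ i`. -/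
def mono (i : MultiIndex d) (x : Fin d → ℝ) : ℝ := ∏ l, x l ^ i l

@[simp]
theorem mono_zero (x : Fin d → ℝ) : mono 0 x = 1 := by simp [mono]

theorem mono_add (i j : MultiIndex d) (x : Fin d → ℝ) : mono (i + j) x = mono i x * mono j x := by
  simp [mono, pow_add, Finset.prod_mul_distrib]

theorem mono_single (l : Fin d) (x : Fin d → ℝ) : mono (Finsupp.single l 1) x = x l := by
  rw [mono, Finset.prod_eq_single l] <;> simp +contextual [eq_comm]

theorem eval_eq_sum_mono (p : MvPolynomial (Fin d) ℝ) (x : Fin d → ℝ) :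
    MvPolynomial.eval x p = ∑ γ ∈ p.support, p.coeff γ * mono γ x :=
  MvPolynomial.eval_eq' x p

/-- The moments of the signed measure with weights `w` at the points of `s`. -/
noncomputable def atomicMoments (s : Finset (Fin d → ℝ)) (w : (Fin d → ℝ) → ℝ) : FullSeq d :=
  fun i => ∑ x ∈ s, w x * mono i x

/-- Localizing by `q` only changes the weights, possibly their signs. This is why `w` is allowed to
be an arbitrary real function. -/
theorem polyShift_atomicMoments (q : MvPolynomial (Fin d) ℝ) (s : Finset (Fin d → ℝ))
    (w : (Fin d → ℝ) → ℝ) :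
    polyShift q (atomicMoments s w) =
      atomicMoments s (fun x => w x * MvPolynomial.eval x q) := by
  ext α
  simp only [polyShift, atomicMoments, Finset.mul_sum, eval_eq_sum_mono, Finset.sum_mul]
  rw [Finset.sum_comm]
  refine Finset.sum_congr rfl fun x _ => Finset.sum_congr rfl fun γ _ => ?_
  rw [mono_add]
  ring

/-- The values of the monomials of degree at most `k` at the points of `s`. -/
def vandermonde (k : ℕ) (s : Finset (Fin d → ℝ)) : Matrix (TruncIndex d k) s ℝ :=
  fun i x => mono i.1 x.1

theorem momentMatrix_atomicMoments (k : ℕ) (s : Finset (Fin d → ℝ)) (w : (Fin d → ℝ) → ℝ) :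
    momentMatrix k (truncate (2 * k) (atomicMoments s w)) =
      vandermonde k s * Matrix.diagonal (fun x : s => w x.1) * (vandermonde k s)ᵀ := by
  classical
  ext i j
  rw [Matrix.mul_apply]
  simp only [momentMatrix, truncate, atomicMoments, Matrix.mul_diagonal, Matrix.transpose_apply,
    vandermonde]
  rw [← Finset.sum_coe_sort s]
  refine Finset.sum_congr rfl fun x _ => ?_
  rw [mono_add]
  ring

theorem rank_momentMatrix_atomicMoments_le (k : ℕ) (s : Finset (Fin d → ℝ))
    (w : (Fin d → ℝ) → ℝ) :
    (momentMatrix k (truncate (2 * k) (atomicMoments s w))).rank ≤ s.card := by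
  rw [momentMatrix_atomicMoments]
  refine (Matrix.rank_mul_le_right _ _).trans ?_
  simpa using (vandermonde k s)ᵀ.rank_le_card_height

theorem exists_leftInverse_vandermonde {k : ℕ} {s : Finset (Fin d → ℝ)} {w : (Fin d → ℝ) → ℝ}
    (h : s.card ≤ (momentMatrix k (truncate (2 * k) (atomicMoments s w))).rank) :
    ∃ B : Matrix s (TruncIndex d k) ℝ, B * vandermonde k s = 1 := by
  apply Matrix.exists_mul_eq_one_of_card_le_rank
  rw [momentMatrix_atomicMoments, Matrix.mul_assoc] at h
  simpa using h.trans (Matrix.rank_mul_le_left _ _)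

/-- The restriction of the index set of `M(k)` to that of `M(n)`. -/
def TruncIndex.castLE {n k : ℕ} (h : n ≤ k) (i : TruncIndex d n) : TruncIndex d k :=
  ⟨i.1, i.2.trans h⟩

theorem rank_momentMatrix_mono {n k : ℕ} (h : n ≤ k) (γ : FullSeq d) :
    (momentMatrix n (truncate (2 * n) γ)).rank ≤ (momentMatrix k (truncate (2 * k) γ)).rank := by
  have h1 := Matrix.eRank_submatrix_le (momentMatrix k (truncate (2 * k) γ))
    (TruncIndex.castLE h) (TruncIndex.castLE h)
  rw [← Matrix.eRank_toNat_eq_rank, ← Matrix.eRank_toNat_eq_rank]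
  refine ENat.toNat_le_toNat h1 ?_
  exact ne_top_of_le_ne_top (by simp) (Matrix.eRank_le_card_width _)

theorem degree_le_of_mem_support {p : MvPolynomial (Fin d) ℝ} {N : ℕ} (hp : p.totalDegree ≤ N)
    {γ : MultiIndex d} (hγ : γ ∈ p.support) : γ.degree ≤ N :=
  (MvPolynomial.le_totalDegree hγ).trans hp

/-- Polynomials interpolating the points of `s`. -/
theorem exists_interpolating_polynomial {k : ℕ} {s : Finset (Fin d → ℝ)}
    {B : Matrix s (TruncIndex d k) ℝ} (hB : B * vandermonde k s = 1) :
    ∃ p : (Fin d → ℝ) → MvPolynomial (Fin d) ℝ, (∀ y, (p y).totalDegree ≤ k) ∧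
      ∀ x ∈ s, ∀ y ∈ s, MvPolynomial.eval x (p y) = if y = x then 1 else 0 := by
  classical
  -- Row `y` of the left inverse is the coefficient vector of the polynomial that is 1 at `y` and 0
  -- at the other points of `s`.
  refine ⟨fun y => if h : y ∈ s then
    ∑ i : TruncIndex d k, MvPolynomial.monomial i.1 (B ⟨y, h⟩ i) else 0, fun y => ?_, ?_⟩
  · dsimp only
    split_ifs with h
    · refine MvPolynomial.totalDegree_finsetSum_le fun i _ => ?_
      exact (MvPolynomial.totalDegree_monomial_le _ _).trans i.2
    · simp
  · intro x hx y hy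
    have h1 := congrFun (congrFun hB ⟨y, hy⟩) ⟨x, hx⟩
    rw [Matrix.mul_apply, Matrix.one_apply] at h1
    simp only [Subtype.mk.injEq] at h1
    dsimp only
    rw [dif_pos hy, map_sum, ← h1]
    refine Finset.sum_congr rfl fun i _ => ?_
    rw [MvPolynomial.eval_monomial, Finsupp.prod_fintype _ _ (by simp)]
    rfl

end TruncatedMoment

/-! ### Atomic measures and uniqueness of representing measures -/

namespace TruncatedMoment

variable {d : ℕ}

theorem integrable_sum_dirac (s : Finset (Fin d → ℝ)) (c : (Fin d → ℝ) → ℝ≥0)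
    (f : (Fin d → ℝ) → ℝ) : Integrable f (∑ x ∈ s, c x • Measure.dirac x) := by
  refine integrable_finsetSum_measure.2 fun x _ => ?_
  exact (integrable_dirac (by simp)).smul_measure_nnreal

theorem integral_sum_dirac (s : Finset (Fin d → ℝ)) (c : (Fin d → ℝ) → ℝ≥0)
    (f : (Fin d → ℝ) → ℝ) :
    ∫ x, f x ∂(∑ x ∈ s, c x • Measure.dirac x) = ∑ x ∈ s, (c x : ℝ) * f x := by
  rw [integral_finsetSum_measure]
  · refine Finset.sum_congr rfl fun x _ => ?_
    rw [integral_smul_nnreal_measure, integral_dirac]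
    rfl
  · exact fun x _ => (integrable_dirac (by simp)).smul_measure_nnreal

theorem sum_dirac_apply (s : Finset (Fin d → ℝ)) (c : (Fin d → ℝ) → ℝ≥0)
    (t : Set (Fin d → ℝ)) :
    (∑ x ∈ s, c x • Measure.dirac x) t = ∑ x ∈ s, (c x : ENNReal) * t.indicator 1 x := by
  rw [Measure.finsetSum_apply]
  refine Finset.sum_congr rfl fun x _ => ?_
  rw [Measure.smul_apply, Measure.dirac_apply]
  rfl

theorem sum_dirac_apply_eq_zero_iff {s : Finset (Fin d → ℝ)} {c : (Fin d → ℝ) → ℝ≥0}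
    (hc : ∀ x ∈ s, 0 < c x) (t : Set (Fin d → ℝ)) :
    (∑ x ∈ s, c x • Measure.dirac x) t = 0 ↔ ∀ x ∈ s, x ∉ t := by
  rw [sum_dirac_apply, Finset.sum_eq_zero_iff]
  refine forall₂_congr fun x hx => ?_
  have := (hc x hx).ne'
  simp [this]

theorem atoms_sum_dirac {s : Finset (Fin d → ℝ)} {c : (Fin d → ℝ) → ℝ≥0}
    (hc : ∀ x ∈ s, 0 < c x) : atoms (∑ x ∈ s, c x • Measure.dirac x) = s := by
  ext x
  rw [atoms, Set.mem_ofPred_eq, Ne, sum_dirac_apply_eq_zero_iff hc]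
  simp

theorem represents_sum_dirac_iff {N : ℕ} (s : Finset (Fin d → ℝ)) (c : (Fin d → ℝ) → ℝ≥0)
    (β : TruncSeq d N) :
    Represents (∑ x ∈ s, c x • Measure.dirac x) β ↔
      truncate N (atomicMoments s fun x => c x) = β := by
  rw [funext_iff]
  refine forall_congr' fun i => ?_
  rw [integral_sum_dirac]
  exact and_iff_right (integrable_sum_dirac s c _)

theorem Represents.integrable_eval {N : ℕ} {μ : Measure (Fin d → ℝ)} {β : TruncSeq d N}
    (h : Represents μ β) {p : MvPolynomial (Fin d) ℝ} (hp : p.totalDegree ≤ N) :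
    Integrable (fun x => MvPolynomial.eval x p) μ := by
  simp only [eval_eq_sum_mono]
  refine integrable_finsetSum _ fun γ hγ => Integrable.const_mul ?_ _
  exact (h ⟨γ, degree_le_of_mem_support hp hγ⟩).1

theorem Represents.integral_eval_eq {N : ℕ} {μ ν : Measure (Fin d → ℝ)} {β : TruncSeq d N}
    (hμ : Represents μ β) (hν : Represents ν β) {p : MvPolynomial (Fin d) ℝ}
    (hp : p.totalDegree ≤ N) :
    ∫ x, MvPolynomial.eval x p ∂μ = ∫ x, MvPolynomial.eval x p ∂ν := by
  have key : ∀ {ρ : Measure (Fin d → ℝ)}, Represents ρ β →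
      ∫ x, MvPolynomial.eval x p ∂ρ = ∑ γ ∈ p.support.attach,
        p.coeff γ.1 * β ⟨γ.1, degree_le_of_mem_support hp γ.2⟩ := by
    intro ρ h
    simp only [eval_eq_sum_mono]
    rw [integral_finsetSum, ← Finset.sum_attach]
    · refine Finset.sum_congr rfl fun γ _ => ?_
      rw [integral_const_mul]
      exact congrArg _ (h ⟨γ.1, degree_le_of_mem_support hp γ.2⟩).2
    · intro γ hγ
      exact Integrable.const_mul (h ⟨γ, degree_le_of_mem_support hp hγ⟩).1 _
  rw [key hμ, key hν]

/-- A measure is determined by its moments of degree at most `2 (k + 1)` if these are the moments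
of an atomic measure whose atoms can be interpolated by polynomials of degree at most `k`. -/
theorem Represents.eq_sum_dirac {k : ℕ} {s : Finset (Fin d → ℝ)} {c : (Fin d → ℝ) → ℝ≥0}
    {B : Matrix s (TruncIndex d k) ℝ} (hB : B * vandermonde k s = 1)
    {β : TruncSeq d (2 * (k + 1))} (hμ : Represents (∑ x ∈ s, c x • Measure.dirac x) β)
    {ν : Measure (Fin d → ℝ)} (hν : Represents ν β) :
    ν = ∑ x ∈ s, c x • Measure.dirac x := by
  classical
  obtain ⟨p, hdeg, hp⟩ := exists_interpolating_polynomial hB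
  -- The moments of `ν` reach the degree of `g ^ 2`, so its integral is a weighted sum of squares
  -- over `s`, which is zero.
  have vanish : ∀ g : MvPolynomial (Fin d) ℝ, g.totalDegree ≤ k + 1 →
      (∀ x ∈ s, MvPolynomial.eval x g = 0) → ∀ᵐ x ∂ν, MvPolynomial.eval x g = 0 := by
    intro g hg hs
    have hg2 : (g ^ 2).totalDegree ≤ 2 * (k + 1) :=
      (MvPolynomial.totalDegree_pow _ _).trans (Nat.mul_le_mul_left _ hg)
    have h0 : ∫ x, MvPolynomial.eval x (g ^ 2) ∂ν = 0 := by
      rw [hν.integral_eval_eq hμ hg2, integral_sum_dirac]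
      exact Finset.sum_eq_zero fun x hx => by simp [hs x hx]
    rw [integral_eq_zero_iff_of_nonneg (fun x => by simp [sq_nonneg]) (hν.integrable_eval hg2)]
      at h0
    filter_upwards [h0] with x hx
    simpa using hx
  have h1 : ∀ᵐ x ∂ν, MvPolynomial.eval x (1 - ∑ y ∈ s, p y) = 0 := by
    refine vanish _ ?_ fun x hx => ?_
    · refine (MvPolynomial.totalDegree_sub _ _).trans (max_le (by simp) ?_)
      exact MvPolynomial.totalDegree_finsetSum_le fun y _ => (hdeg y).trans (Nat.le_succ k)
    · rw [map_sub, map_sum, Finset.sum_congr rfl (hp x hx), map_one]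
      simp [hx]
  -- These products vanish on `s` and have degree at most `k + 1`, hence the moments up to `2 * (k +
  -- 1)`. By `h1` some `p y` is nonzero at almost every `x`, and then `x = y`.
  have h2 : ∀ᵐ x ∂ν, ∀ y ∈ s, ∀ l : Fin d,
      MvPolynomial.eval x ((MvPolynomial.X l - MvPolynomial.C (y l)) * p y) = 0 := by
    refine (ae_ball_iff s.countable_toSet).2 fun y hy => ae_all_iff.2 fun l => ?_
    refine vanish _ ?_ fun x hx => ?_
    · refine (MvPolynomial.totalDegree_mul _ _).trans ?_
      have h3 : (MvPolynomial.X l - MvPolynomial.C (y l) :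
          MvPolynomial (Fin d) ℝ).totalDegree ≤ 1 :=
        (MvPolynomial.totalDegree_sub _ _).trans (max_le (by simp) (by simp))
      have := hdeg y
      omega
    · rw [map_mul, hp x hx y hy]
      split_ifs with h
      · simp [h]
      · simp
  have hsupp : ∀ᵐ x ∂ν, x ∈ s := by
    filter_upwards [h1, h2] with x hx1 hx2
    have : ∃ y ∈ s, MvPolynomial.eval x (p y) ≠ 0 := by
      by_contra! hcon
      rw [map_sub, map_sum, Finset.sum_eq_zero hcon] at hx1
      simp at hx1
    obtain ⟨y, hy, hne⟩ := this
    have hxy : x = y := by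
      ext l
      have := hx2 y hy l
      rw [map_mul] at this
      have := (mul_eq_zero.1 this).resolve_right hne
      simpa [sub_eq_zero] using this
    exact hxy ▸ hy
  have hfin : IsFiniteMeasure ν := by
    have := (hν ⟨0, by simp⟩).1
    simp only [Finsupp.coe_zero, Pi.zero_apply, pow_zero, Finset.prod_const_one] at this
    exact (integrable_const_iff_isFiniteMeasure one_ne_zero).1 this
  have hmass : ∀ y ∈ s, ν {y} = c y := by
    intro y hy
    have hp2 : (p y ^ 2).totalDegree ≤ 2 * (k + 1) :=
      (MvPolynomial.totalDegree_pow _ _).trans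
        (Nat.mul_le_mul_left _ ((hdeg y).trans (Nat.le_succ k)))
    have h3 : ∫ x, MvPolynomial.eval x (p y ^ 2) ∂ν = c y := by
      rw [hν.integral_eval_eq hμ hp2, integral_sum_dirac, Finset.sum_eq_single y]
      · simp [hp y hy y hy]
      · intro x hx hne
        simp [hp x hx y hy, hne.symm]
      · exact fun h => absurd hy h
    -- On `s`, which carries `ν`, the polynomial `p y ^ 2` is the indicator of `y`.
    have h4 : ∫ x, MvPolynomial.eval x (p y ^ 2) ∂ν = ν.real {y} := by
      rw [← integral_indicator_one (measurableSet_singleton y)]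
      refine integral_congr_ae ?_
      filter_upwards [hsupp] with x hx
      rw [map_pow, hp x hx y hy]
      by_cases h : y = x
      · simp [h]
      · simp [h, Ne.symm h]
    rw [h4] at h3
    rw [← ENNReal.ofReal_coe_nnreal, ← h3, measureReal_def, ENNReal.ofReal_toReal]
    exact measure_ne_top _ _
  ext t ht
  rw [sum_dirac_apply]
  have h5 : ν t = ν (t ∩ s) := by
    refine measure_congr ?_
    filter_upwards [hsupp] with x hx
    exact propext ⟨fun h => ⟨h, hx⟩, fun h => h.1⟩
  have h6 : t ∩ (s : Set (Fin d → ℝ)) = ((s.filter (· ∈ t) : Finset (Fin d → ℝ)) : Set _) := by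
    ext x
    simp [and_comm]
  rw [h5, h6, ← sum_measure_singleton, Finset.sum_filter]
  refine Finset.sum_congr rfl fun x hx => ?_
  by_cases h : x ∈ t <;> simp [h, hmass x hx]

end TruncatedMoment

/-! ### Gram vectors and multiplication operators -/

namespace TruncatedMoment

variable {d : ℕ}

/-- Multiplication by the variable `l`, from monomials of degree at most `n` to monomials of
degree at most `n + 1`. -/
noncomputable def TruncIndex.shift {n : ℕ} (l : Fin d) (i : TruncIndex d n) :
    TruncIndex d (n + 1) :=
  ⟨i.1 + Finsupp.single l 1, by
    have := i.2
    rw [map_add, Finsupp.degree_single]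
    omega⟩

section Operators

variable {E : Type*} [NormedAddCommGroup E] [InnerProductSpace ℝ E] {n : ℕ}

/-- `v` is a family of vectors whose Gram matrix is the moment matrix of `β`. -/
def IsGramFamily (β : TruncSeq d (2 * (n + 1))) (v : TruncIndex d (n + 1) → E) : Prop :=
  ∀ i j, ⟪v i, v j⟫_ℝ = momentMatrix (n + 1) β i j

/-- This Hankel property makes the multiplication operators well defined, symmetric and commuting.
-/
theorem IsGramFamily.inner_eq {β : TruncSeq d (2 * (n + 1))} {v : TruncIndex d (n + 1) → E}
    (hv : IsGramFamily β v) {i j i' j' : TruncIndex d (n + 1)} (h : i.1 + j.1 = i'.1 + j'.1) :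
    ⟪v i, v j⟫_ℝ = ⟪v i', v j'⟫_ℝ := by
  rw [hv, hv, momentMatrix, momentMatrix]
  congr 2

/-- The multiplication operators on a space spanned by the vectors attached to the monomials of
degree at most `n`. -/
theorem IsGramFamily.exists_mul_operator {β : TruncSeq d (2 * (n + 1))}
    {v : TruncIndex d (n + 1) → E} (hv : IsGramFamily β v)
    (hspan : Submodule.span ℝ (Set.range fun i : TruncIndex d n => v (i.castLE n.le_succ)) = ⊤)
    (l : Fin d) :
    ∃ T : E →ₗ[ℝ] E, ∀ i : TruncIndex d n, T (v (i.castLE n.le_succ)) = v (i.shift l) := by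
  set f := Fintype.linearCombination ℝ fun i : TruncIndex d n => v (i.castLE n.le_succ) with hf
  set g := Fintype.linearCombination ℝ fun i : TruncIndex d n => v (i.shift l) with hg
  have hfr : LinearMap.range f = ⊤ := by rw [hf, Fintype.range_linearCombination, hspan]
  obtain ⟨S, hS⟩ := f.exists_rightInverse_of_surjective hfr
  -- Well-definedness: a linear relation among the `v i` survives the shift, because the shift can
  -- be moved to the other factor of the inner product.
  have hker : ∀ a, f a = 0 → g a = 0 := by
    intro a ha
    have horth : ∀ y : E, ⟪g a, y⟫_ℝ = 0 := by
      intro y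
      have hy : y ∈ Submodule.span ℝ
        (Set.range fun i : TruncIndex d n => v (i.castLE n.le_succ)) := by simp [hspan]
      induction hy using Submodule.span_induction with
      | mem y hy =>
        obtain ⟨j, rfl⟩ := hy
        have h1 : ⟪g a, v (j.castLE n.le_succ)⟫_ℝ = ⟪f a, v (j.shift l)⟫_ℝ := by
          simp only [hf, hg, Fintype.linearCombination_apply, sum_inner, inner_smul_left]
          refine Finset.sum_congr rfl fun i _ => congrArg _ (hv.inner_eq ?_)
          simp only [TruncIndex.shift, TruncIndex.castLE]
          abel
        rw [h1, ha, inner_zero_left]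
      | zero => exact inner_zero_right _
      | add x y _ _ hx hy => rw [inner_add_right, hx, hy, add_zero]
      | smul c x _ hx => rw [inner_smul_right, hx, mul_zero]
    exact inner_self_eq_zero.1 (horth _)
  refine ⟨g ∘ₗ S, fun i => ?_⟩
  classical
  have h1 : f (Pi.single i 1) = v (i.castLE n.le_succ) := by
    rw [hf, Fintype.linearCombination_apply_single, one_smul]
  have h2 : g (Pi.single i 1) = v (i.shift l) := by
    rw [hg, Fintype.linearCombination_apply_single, one_smul]
  rw [LinearMap.comp_apply, ← h2, ← sub_eq_zero, ← map_sub]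
  apply hker
  rw [map_sub, h1, sub_eq_zero]
  exact LinearMap.congr_fun hS _

/-- Simultaneous diagonalization of the multiplication operators. -/
theorem IsGramFamily.exists_orthogonal_decomposition [FiniteDimensional ℝ E]
    {β : TruncSeq d (2 * (n + 1))} {v : TruncIndex d (n + 1) → E} (hv : IsGramFamily β v)
    (hspan : Submodule.span ℝ (Set.range fun i : TruncIndex d n => v (i.castLE n.le_succ)) = ⊤) :
    ∃ (s : Finset (Fin d → ℝ)) (e : (Fin d → ℝ) → E), (∀ x ∈ s, e x ≠ 0) ∧
      (∀ x y, x ≠ y → ⟪e x, e y⟫_ℝ = 0) ∧ ∀ i, v i = ∑ x ∈ s, mono i.1 x • e x := by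
  choose T hT using hv.exists_mul_operator hspan
  have hext : ∀ A B : E →ₗ[ℝ] E, (∀ i : TruncIndex d n,
      A (v (i.castLE n.le_succ)) = B (v (i.castLE n.le_succ))) → A = B := by
    intro A B h
    apply LinearMap.ext_on hspan
    rintro _ ⟨i, rfl⟩
    exact h i
  have hsymm : ∀ l, (T l).IsSymmetric := by
    intro l
    have h1 : ((innerₗ E).compl₁₂ (T l) LinearMap.id) = (innerₗ E).compl₁₂ LinearMap.id (T l) := by
      apply LinearMap.ext_on hspan
      rintro _ ⟨i, rfl⟩
      apply LinearMap.ext_on hspan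
      rintro _ ⟨j, rfl⟩
      simp only [LinearMap.compl₁₂_apply, LinearMap.id_apply, innerₗ_apply_apply, hT]
      apply hv.inner_eq
      simp only [TruncIndex.shift, TruncIndex.castLE]
      abel
    intro x y
    exact LinearMap.congr_fun (LinearMap.congr_fun h1 x) y
  have hcomm : ∀ l l', T l * T l' = T l' * T l := by
    intro l l'
    apply hext
    intro i
    apply ext_inner_right ℝ
    intro y
    have hy : y ∈ Submodule.span ℝ
      (Set.range fun i : TruncIndex d n => v (i.castLE n.le_succ)) := by simp [hspan]
    simp only [Module.End.mul_apply, hT]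
    -- `v (i.shift l')` may have degree `n + 1`, where `T l` is not given by a shift. Symmetry moves
    -- the outer operators to `y`, which may be taken among the spanning vectors.
    rw [hsymm, hsymm]
    induction hy using Submodule.span_induction with
    | mem y hy =>
      obtain ⟨j, rfl⟩ := hy
      rw [hT, hT]
      apply hv.inner_eq
      simp only [TruncIndex.shift]
      abel
    | zero => simp
    | add x y _ _ hx hy => simp only [map_add, inner_add_right, hx, hy]
    | smul c x _ hx => simp only [map_smul, inner_smul_right, hx]
  have htop := LinearMap.IsSymmetric.iSup_iInf_eq_top_of_commute hsymm
    (fun l l' _ => hcomm l l')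
  -- The vector of the constant monomial is a finite sum of joint eigenvectors; the joint
  -- eigenvalues that occur become the atoms.
  have hmem : v ⟨0, by simp⟩ ∈
      ⨆ χ : Fin d → ℝ, ⨅ l, Module.End.eigenspace (T l) (χ l) := by simp [htop]
  rw [Submodule.mem_iSup_iff_exists_finsupp] at hmem
  obtain ⟨e, he, hsum⟩ := hmem
  refine ⟨e.support, e, fun x hx => Finsupp.mem_support_iff.1 hx, fun x y hxy => ?_, ?_⟩
  · exact LinearMap.IsSymmetric.orthogonalFamily_iInf_eigenspaces hsymm hxy
      ⟨e x, he x⟩ ⟨e y, he y⟩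
  · rintro ⟨i, hi⟩
    induction hk : i.degree generalizing i with
    | zero =>
      obtain rfl := (Finsupp.degree_eq_zero_iff i).1 hk
      simpa [Finsupp.sum] using hsum.symm
    | succ k ih =>
      obtain ⟨l, hl⟩ : ∃ l, i l ≠ 0 := by
        by_contra! h
        rw [(Finsupp.degree_eq_zero_iff i).2 (Finsupp.ext h)] at hk
        omega
      obtain ⟨j, rfl⟩ : ∃ j, i = j + Finsupp.single l 1 := by
        refine ⟨i - Finsupp.single l 1, (tsub_add_cancel_of_le ?_).symm⟩
        exact Finsupp.single_le_iff.2 (Nat.one_le_iff_ne_zero.2 hl)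
      rw [map_add, Finsupp.degree_single] at hk hi
      have h1 := ih j (by omega) (by omega)
      have h2 := hT l ⟨j, by omega⟩
      simp only [TruncIndex.castLE, TruncIndex.shift] at h2
      rw [← h2, h1, map_sum]
      refine Finset.sum_congr rfl fun x _ => ?_
      have h3 : T l (e x) = x l • e x :=
        Module.End.mem_eigenspace_iff.1 ((Submodule.mem_iInf _).1 (he x) l)
      rw [map_smul, h3, smul_smul, mono_add, mono_single]

end Operators

/-! ### The flat extension theorem -/

theorem momentMatrix_transpose (k : ℕ) (β : TruncSeq d (2 * k)) :
    (momentMatrix k β)ᵀ = momentMatrix k β := by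
  ext i j
  simp only [Matrix.transpose_apply, momentMatrix, add_comm]

theorem IsFlatExtension.submatrix_eq {n : ℕ} {β : TruncSeq d (2 * n)}
    {β' : TruncSeq d (2 * (n + 1))} (h : IsFlatExtension n β β') :
    (momentMatrix (n + 1) β').submatrix (TruncIndex.castLE n.le_succ)
      (TruncIndex.castLE n.le_succ) = momentMatrix n β := by
  ext i j
  have hi := i.2
  have hj := j.2
  exact h.1 ⟨i.1 + j.1, by rw [map_add]; omega⟩

/-- Flatness makes `M(n + 1)` positive semidefinite, hence a Gram matrix, and its column relations
carry over to the vectors. Passing to the span `E` makes the vectors of degree at most `n` generate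
the whole space. -/
theorem exists_isGramFamily {n : ℕ} {β : TruncSeq d (2 * n)} (hβ : (momentMatrix n β).PosSemidef)
    {β' : TruncSeq d (2 * (n + 1))} (h : IsFlatExtension n β β') :
    ∃ (m : ℕ) (E : Submodule ℝ (EuclideanSpace ℝ (Fin m)))
      (v : TruncIndex d (n + 1) → E), IsGramFamily β' v ∧
      Submodule.span ℝ (Set.range fun i : TruncIndex d n => v (i.castLE n.le_succ)) = ⊤ := by
  classical
  set M := momentMatrix (n + 1) β' with hM
  have hsub := h.submatrix_eq
  have hrank : M.rank = (M.submatrix (TruncIndex.castLE n.le_succ)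
      (TruncIndex.castLE n.le_succ)).rank := by rw [hsub, h.2]
  have hpos : M.PosSemidef :=
    Matrix.PosSemidef.of_submatrix_of_rank_eq (momentMatrix_transpose _ _) (hsub ▸ hβ) hrank
  obtain ⟨m, b, hb⟩ := Matrix.posSemidef_iff_eq_sum_vecMulVec.1 hpos
  obtain ⟨Y, hY⟩ := Matrix.exists_submatrix_mul_eq_of_rank_eq M _ hrank
  set u : TruncIndex d (n + 1) → EuclideanSpace ℝ (Fin m) :=
    fun j => WithLp.toLp 2 fun k => b k j with hu
  have hinner : ∀ i j, ⟪u i, u j⟫_ℝ = M i j := by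
    intro i j
    rw [hb, Matrix.sum_apply, hu, PiLp.inner_apply]
    refine Finset.sum_congr rfl fun k _ => ?_
    simp [Matrix.vecMulVec_apply, mul_comm]
  have hcol : ∀ j, u j = ∑ k : TruncIndex d n, Y k j • u (k.castLE n.le_succ) := by
    intro j
    set z := u j - ∑ k : TruncIndex d n, Y k j • u (k.castLE n.le_succ) with hz
    have h1 : ∀ i, ⟪u i, z⟫_ℝ = 0 := by
      intro i
      rw [hz, inner_sub_right, inner_sum]
      simp only [inner_smul_right, hinner]
      have := congrFun (congrFun hY i) j
      rw [Matrix.mul_apply] at this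
      rw [← this, sub_eq_zero]
      exact Finset.sum_congr rfl fun k _ => mul_comm _ _
    -- `z` is a combination of the `u i` and is orthogonal to all of them.
    have h2 : ⟪z, z⟫_ℝ = 0 := by
      nth_rw 1 [hz]
      rw [inner_sub_left, sum_inner]
      simp only [inner_smul_left, h1, mul_zero, Finset.sum_const_zero, sub_zero]
    exact sub_eq_zero.1 (inner_self_eq_zero.1 h2)
  set E := Submodule.span ℝ (Set.range fun k : TruncIndex d n => u (k.castLE n.le_succ)) with hE
  have hmem : ∀ j, u j ∈ E := by
    intro j
    rw [hcol j]
    exact Submodule.sum_mem _ fun k _ => Submodule.smul_mem _ _ (Submodule.subset_span ⟨k, rfl⟩)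
  refine ⟨m, E, fun j => ⟨u j, hmem j⟩, fun i j => hinner i j, ?_⟩
  rw [eq_top_iff]
  intro x _
  have hx : x.1 ∈ (Submodule.span ℝ (Set.range fun k : TruncIndex d n =>
      (⟨u (k.castLE n.le_succ), hmem _⟩ : E))).map E.subtype := by
    rw [Submodule.map_span, ← Set.range_comp]
    exact x.2
  obtain ⟨y, hy, hyx⟩ := hx
  rwa [← Subtype.ext hyx]

/-- If the points of `s` can be interpolated in degree `k`, the rank of the moment matrix counts
the points with nonzero weight. -/
theorem rank_momentMatrix_atomicMoments {k : ℕ} {s : Finset (Fin d → ℝ)}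
    {B : Matrix s (TruncIndex d k) ℝ} (hB : B * vandermonde k s = 1) (w : (Fin d → ℝ) → ℝ) :
    (momentMatrix k (truncate (2 * k) (atomicMoments s w))).rank =
      (s.filter (w · ≠ 0)).card := by
  classical
  rw [momentMatrix_atomicMoments, Matrix.rank_mul_diagonal_mul_transpose hB, Matrix.rank_diagonal,
    Fintype.card_subtype, ← Finset.card_map (Function.Embedding.subtype _)]
  congr 1
  ext x
  simp [and_comm]

/-- The flat extension theorem: a flat extension of a positive semidefinite moment matrix comes
from an atomic measure whose number of atoms is the rank. -/
theorem exists_atomicMoments_of_isFlatExtension {n : ℕ} {β : TruncSeq d (2 * n)}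
    (hβ : (momentMatrix n β).PosSemidef) {β' : TruncSeq d (2 * (n + 1))}
    (h : IsFlatExtension n β β') :
    ∃ (s : Finset (Fin d → ℝ)) (c : (Fin d → ℝ) → ℝ≥0), s.card = (momentMatrix n β).rank ∧
      (∀ x ∈ s, 0 < c x) ∧ truncate (2 * (n + 1)) (atomicMoments s fun x => c x) = β' := by
  classical
  obtain ⟨m, E, v, hv, hspan⟩ := exists_isGramFamily hβ h
  obtain ⟨s, e, hne, horth, hdecomp⟩ := hv.exists_orthogonal_decomposition hspan
  have hinner : ∀ i, ∀ y ∈ s, ⟪v i, e y⟫_ℝ = mono i.1 y * ‖e y‖ ^ 2 := by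
    intro i y hy
    rw [hdecomp, sum_inner, Finset.sum_eq_single y]
    · rw [real_inner_smul_left, real_inner_self_eq_norm_sq]
    · intro x _ hxy
      rw [real_inner_smul_left, horth x y hxy, mul_zero]
    · exact fun h => absurd hy h
  have htrunc : truncate (2 * (n + 1))
      (atomicMoments s fun x => ((‖e x‖₊ ^ 2 : ℝ≥0) : ℝ)) = β' := by
    ext i
    -- An index of degree at most `2 * (n + 1)` splits into two of degree at most `n + 1`, so every
    -- moment is an entry of the Gram matrix.
    obtain ⟨a, b, ha, hb, hab⟩ : ∃ a b : MultiIndex d, a.degree ≤ n + 1 ∧ b.degree ≤ n + 1 ∧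
        a + b = i.1 := by
      have hi := i.2
      obtain ⟨a, hai, ha⟩ := Finsupp.exists_le_degree_eq i.1 (min (n + 1) i.1.degree)
        (min_le_right _ _)
      have hadd := add_tsub_cancel_of_le hai
      refine ⟨a, i.1 - a, ha.trans_le (min_le_left _ _), ?_, hadd⟩
      have := congrArg Finsupp.degree hadd
      rw [map_add] at this
      omega
    have h1 : β' i = ⟪v ⟨a, ha⟩, v ⟨b, hb⟩⟫_ℝ := by
      rw [hv, momentMatrix]
      exact congrArg β' (Subtype.ext hab.symm)
    rw [h1, hdecomp ⟨b, hb⟩, inner_sum, truncate, atomicMoments]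
    refine Finset.sum_congr rfl fun x hx => ?_
    rw [real_inner_smul_right, hinner _ x hx, ← hab, mono_add]
    push_cast
    ring
  refine ⟨s, fun x => ‖e x‖₊ ^ 2, ?_, fun x hx => pow_pos (nnnorm_pos.2 (hne x hx)) 2, htrunc⟩
  -- Each `e x` is a combination of vectors of degree at most `n`. Pairing with `e y` shows that the
  -- coefficients interpolate, so the number of atoms is the rank of `M(n)`.
  have hcoef : ∀ x : s, ∃ a : TruncIndex d n → ℝ, ∑ i, a i • v (i.castLE n.le_succ) = e x := by
    intro x
    have hx : e x ∈ Submodule.span ℝ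
      (Set.range fun i : TruncIndex d n => v (i.castLE n.le_succ)) := by simp [hspan]
    exact (Submodule.mem_span_range_iff_exists_fun ℝ).1 hx
  choose A hA using hcoef
  have hB : Matrix.of A * vandermonde n s = 1 := by
    ext x y
    have hy : ‖e y‖ ^ 2 ≠ 0 := pow_ne_zero 2 (norm_ne_zero_iff.2 (hne y y.2))
    have h1 : ⟪e x, e y⟫_ℝ = (∑ i, A x i * mono i.1 y.1) * ‖e y‖ ^ 2 := by
      rw [← hA x, sum_inner, Finset.sum_mul]
      refine Finset.sum_congr rfl fun i _ => ?_
      refine (real_inner_smul_left (F := E) _ _ _).trans ?_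
      rw [hinner _ y y.2, mul_assoc]
      rfl
    rw [Matrix.mul_apply, Matrix.one_apply]
    apply mul_right_cancel₀ hy
    refine h1.symm.trans ?_
    split_ifs with hxy
    · rw [hxy, real_inner_self_eq_norm_sq, one_mul]
    · rw [horth _ _ (fun h => hxy (Subtype.ext h)), zero_mul]
  have hβ_eq : β = truncate (2 * n) (atomicMoments s fun x => ((‖e x‖₊ ^ 2 : ℝ≥0) : ℝ)) := by
    ext i
    rw [← h.1 i, ← htrunc]
    rfl
  rw [hβ_eq, rank_momentMatrix_atomicMoments hB, Finset.filter_true_of_mem]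
  intro x hx
  exact NNReal.coe_ne_zero.2 (pow_pos (nnnorm_pos.2 (hne x hx)) 2).ne'

end TruncatedMoment

/-! ### Flat completions, localizing matrices and the theorem -/

namespace TruncatedMoment

variable {d : ℕ}

theorem truncate_eq_of_isFlatExtension {n : ℕ} {β : TruncSeq d (2 * n)}
    {β' : TruncSeq d (2 * (n + 1))} (h : IsFlatExtension n β β') {γ : FullSeq d}
    (hγ : truncate (2 * (n + 1)) γ = β') : truncate (2 * n) γ = β := by
  ext i
  rw [← h.1 i, ← hγ]
  rfl

/-- At each level the rank lies between that of `M(n + 1)` and the number of atoms, and these agree.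
-/
theorem isFlatCompletion_atomicMoments {n : ℕ} {β : TruncSeq d (2 * n)}
    {β' : TruncSeq d (2 * (n + 1))} (h : IsFlatExtension n β β') {s : Finset (Fin d → ℝ)}
    {w : (Fin d → ℝ) → ℝ} (hcard : s.card = (momentMatrix n β).rank)
    (hw : truncate (2 * (n + 1)) (atomicMoments s w) = β') :
    IsFlatCompletion n β' (atomicMoments s w) := by
  refine ⟨hw, fun k hk => le_antisymm ?_ ?_⟩
  · rw [h.2, ← hcard]
    exact rank_momentMatrix_atomicMoments_le k s w
  · rw [← hw]
    exact rank_momentMatrix_mono hk _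

theorem exists_leftInverse_vandermonde_of_isFlatExtension {n : ℕ} {β : TruncSeq d (2 * n)}
    {β' : TruncSeq d (2 * (n + 1))} (h : IsFlatExtension n β β') {s : Finset (Fin d → ℝ)}
    {w : (Fin d → ℝ) → ℝ} (hcard : s.card = (momentMatrix n β).rank)
    (hw : truncate (2 * (n + 1)) (atomicMoments s w) = β') :
    ∃ B : Matrix s (TruncIndex d n) ℝ, B * vandermonde n s = 1 := by
  apply exists_leftInverse_vandermonde (w := w)
  rw [truncate_eq_of_isFlatExtension h hw, hcard]

/-- A flat completion is the moment sequence of any atomic measure, with the right number of atoms,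
that represents the flat extension. -/
theorem IsFlatCompletion.eq_atomicMoments {n : ℕ} {β : TruncSeq d (2 * n)}
    (hβ : (momentMatrix n β).PosSemidef) {β' : TruncSeq d (2 * (n + 1))}
    (h : IsFlatExtension n β β') {γ : FullSeq d} (hγ : IsFlatCompletion n β' γ)
    {s : Finset (Fin d → ℝ)} {c : (Fin d → ℝ) → ℝ≥0} (hcard : s.card = (momentMatrix n β).rank)
    (hc : truncate (2 * (n + 1)) (atomicMoments s fun x => c x) = β') :
    γ = atomicMoments s fun x => c x := by
  obtain ⟨B, hB⟩ := exists_leftInverse_vandermonde_of_isFlatExtension h hcard hc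
  ext i
  obtain ⟨k, hk, hik⟩ : ∃ k, n + 1 ≤ k ∧ i.degree ≤ k :=
    ⟨max (n + 1) i.degree, le_max_left _ _, le_max_right _ _⟩
  have hsub : (momentMatrix k (truncate (2 * k) γ)).submatrix
      (TruncIndex.castLE ((Nat.le_succ n).trans hk))
      (TruncIndex.castLE ((Nat.le_succ n).trans hk)) = momentMatrix n β := by
    rw [← truncate_eq_of_isFlatExtension h hγ.1]
    rfl
  have hpos : (momentMatrix k (truncate (2 * k) γ)).PosSemidef := by
    refine Matrix.PosSemidef.of_submatrix_of_rank_eq (momentMatrix_transpose _ _) (hsub ▸ hβ) ?_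
    rw [hsub, hγ.2 k hk, h.2]
  -- At a level `k` high enough to see `i`, the truncation of `γ` again has a flat extension, so it
  -- comes from an atomic measure. That measure also represents `β'`, and uniqueness identifies it
  -- with the given one.
  have hflat : IsFlatExtension k (truncate (2 * k) γ) (truncate (2 * (k + 1)) γ) :=
    ⟨fun _ => rfl, by rw [hγ.2 k hk, hγ.2 (k + 1) (hk.trans k.le_succ)]⟩
  obtain ⟨s', c', -, -, hc'⟩ := exists_atomicMoments_of_isFlatExtension hpos hflat
  have hrep : Represents (∑ x ∈ s', c' x • Measure.dirac x) β' := by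
    rw [represents_sum_dirac_iff, ← hγ.1]
    ext j
    have hj := j.2
    exact congrFun hc' ⟨j.1, by omega⟩
  have hmeas := Represents.eq_sum_dirac hB ((represents_sum_dirac_iff s c β').2 hc) hrep
  have h1 : γ i = atomicMoments s' (fun x => c' x) i :=
    (congrFun hc' ⟨i, by omega⟩).symm
  rw [h1, atomicMoments, ← integral_sum_dirac, hmeas, integral_sum_dirac]
  rfl

theorem localizingMatrix_atomicMoments (n : ℕ) (q : MvPolynomial (Fin d) ℝ)
    (s : Finset (Fin d → ℝ)) (w : (Fin d → ℝ) → ℝ) :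
    localizingMatrix n q (atomicMoments s w) = momentMatrix n (truncate (2 * n)
      (atomicMoments s fun x => w x * MvPolynomial.eval x q)) := by
  rw [localizingMatrix, polyShift_atomicMoments]

theorem posSemidef_momentMatrix_atomicMoments (k : ℕ) {s : Finset (Fin d → ℝ)}
    {w : (Fin d → ℝ) → ℝ} (hw : ∀ x ∈ s, 0 ≤ w x) :
    (momentMatrix k (truncate (2 * k) (atomicMoments s w))).PosSemidef := by
  classical
  rw [momentMatrix_atomicMoments]
  exact Matrix.posSemidef_mul_diagonal_mul_transpose fun x => hw x x.2

theorem nonneg_of_posSemidef_momentMatrix_atomicMoments {k : ℕ} {s : Finset (Fin d → ℝ)}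
    {B : Matrix s (TruncIndex d k) ℝ} (hB : B * vandermonde k s = 1) {w : (Fin d → ℝ) → ℝ}
    (h : (momentMatrix k (truncate (2 * k) (atomicMoments s w))).PosSemidef) :
    ∀ x ∈ s, 0 ≤ w x := by
  classical
  rw [momentMatrix_atomicMoments] at h
  exact fun x hx => Matrix.nonneg_of_posSemidef_mul_diagonal_mul_transpose hB h ⟨x, hx⟩

theorem rank_momentMatrix_le_of_isAtomicOfCard {n k : ℕ} {β : TruncSeq d (2 * n)}
    {ν : Measure (Fin d → ℝ)} (hν : Represents ν β) (hk : IsAtomicOfCard k ν) :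
    (momentMatrix n β).rank ≤ k := by
  obtain ⟨s, c, rfl, -, rfl⟩ := hk
  rw [represents_sum_dirac_iff] at hν
  rw [← hν]
  exact rank_momentMatrix_atomicMoments_le n s _

/-- The representing measure of a flat extension with positive semidefinite localizing matrices. -/
theorem exists_representing_measure {n m : ℕ} {β : TruncSeq d (2 * n)}
    {q : Fin m → MvPolynomial (Fin d) ℝ} (hβ : (momentMatrix n β).PosSemidef)
    {β' : TruncSeq d (2 * (n + 1))} (h : IsFlatExtension n β β') {γ : FullSeq d}
    (hγ : IsFlatCompletion n β' γ) (hq : ∀ i, (localizingMatrix n (q i) γ).PosSemidef) :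
    ∃ μ : Measure (Fin d → ℝ), Represents μ β' ∧ (∀ ν, Represents ν β' → ν = μ) ∧
      Represents μ β ∧ IsAtomicOfCard (momentMatrix n β).rank μ ∧
      μ (semialgebraicSet q)ᶜ = 0 ∧
      ∀ i, ((atoms μ ∩ zeroSet (q i)).ncard : ℤ) =
        ((momentMatrix n β).rank : ℤ) - ((localizingMatrix n (q i) γ).rank : ℤ) := by
  classical
  obtain ⟨s, c, hcard, hpos, hc⟩ := exists_atomicMoments_of_isFlatExtension hβ h
  obtain ⟨B, hB⟩ := exists_leftInverse_vandermonde_of_isFlatExtension h hcard hc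
  obtain rfl := hγ.eq_atomicMoments hβ h hcard hc
  have hrep := (represents_sum_dirac_iff s c β').2 hc
  refine ⟨∑ x ∈ s, c x • Measure.dirac x, hrep, fun ν hν => Represents.eq_sum_dirac hB hrep hν,
    (represents_sum_dirac_iff s c β).2 (truncate_eq_of_isFlatExtension h hc),
    ⟨s, c, hcard, hpos, rfl⟩, ?_, fun i => ?_⟩
  · rw [sum_dirac_apply_eq_zero_iff hpos]
    intro x hx hxc
    refine hxc fun i => ?_
    have h1 := hq i
    rw [localizingMatrix_atomicMoments] at h1
    exact nonneg_of_mul_nonneg_right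
      (nonneg_of_posSemidef_momentMatrix_atomicMoments hB h1 x hx) (NNReal.coe_pos.2 (hpos x hx))
  · rw [localizingMatrix_atomicMoments, rank_momentMatrix_atomicMoments hB, atoms_sum_dirac hpos,
      ← hcard]
    have h1 : (s : Set (Fin d → ℝ)) ∩ zeroSet (q i) =
        ((s.filter fun x => MvPolynomial.eval x (q i) = 0 : Finset (Fin d → ℝ)) : Set _) := by
      ext x
      simp [zeroSet]
    have h2 : (s.filter fun x => (c x : ℝ) * MvPolynomial.eval x (q i) ≠ 0) =
        s.filter fun x => ¬ MvPolynomial.eval x (q i) = 0 :=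
      Finset.filter_congr fun x hx => by simp [(hpos x hx).ne']
    have h3 := Finset.card_filter_add_card_filter_not (s := s)
      (fun x => MvPolynomial.eval x (q i) = 0)
    rw [h1, Set.ncard_coe_finset, h2]
    omega

/-- The moments of an atomic measure with `rank M(n)` atoms provide a flat extension. -/
theorem exists_isFlatExtension_of_isAtomicOfCard {n m : ℕ} {β : TruncSeq d (2 * n)}
    {q : Fin m → MvPolynomial (Fin d) ℝ} {μ : Measure (Fin d → ℝ)} (hμ : Represents μ β)
    (hcard : IsAtomicOfCard (momentMatrix n β).rank μ) (hK : μ (semialgebraicSet q)ᶜ = 0) :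
    (momentMatrix n β).PosSemidef ∧
      ∃ β' : TruncSeq d (2 * (n + 1)), IsFlatExtension n β β' ∧
        ∃ γ : FullSeq d, IsFlatCompletion n β' γ ∧
          ∀ i, (localizingMatrix n (q i) γ).PosSemidef := by
  obtain ⟨s, c, hs, hpos, rfl⟩ := hcard
  rw [represents_sum_dirac_iff] at hμ
  rw [sum_dirac_apply_eq_zero_iff hpos] at hK
  have hflat : IsFlatExtension n β (truncate (2 * (n + 1)) (atomicMoments s fun x => c x)) := by
    -- The rank of `M(n + 1)` is squeezed between that of `M(n)` and the number of atoms.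
    refine ⟨fun i => congrFun hμ i, le_antisymm ?_ ?_⟩
    · rw [← hs]
      exact rank_momentMatrix_atomicMoments_le _ s _
    · rw [← hμ]
      exact rank_momentMatrix_mono n.le_succ _
  refine ⟨?_, _, hflat, _, isFlatCompletion_atomicMoments hflat hs rfl, fun i => ?_⟩
  · rw [← hμ]
    exact posSemidef_momentMatrix_atomicMoments n fun x _ => (c x).2
  · rw [localizingMatrix_atomicMoments]
    refine posSemidef_momentMatrix_atomicMoments n fun x hx => mul_nonneg (c x).2 ?_
    exact not_not.1 (hK x hx) i

theorem existsUnique_isFlatCompletion {n : ℕ} {β : TruncSeq d (2 * n)}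
    (hβ : (momentMatrix n β).PosSemidef) {β' : TruncSeq d (2 * (n + 1))}
    (h : IsFlatExtension n β β') : ∃! γ : FullSeq d, IsFlatCompletion n β' γ := by
  obtain ⟨s, c, hcard, -, hc⟩ := exists_atomicMoments_of_isFlatExtension hβ h
  exact ⟨_, isFlatCompletion_atomicMoments h hcard hc,
    fun γ hγ => hγ.eq_atomicMoments hβ h hcard hc⟩

end TruncatedMoment

theorem theorem1p2 (d n m : ℕ) (β : TruncatedMoment.TruncSeq d (2 * n))
    (q : Fin m → MvPolynomial (Fin d) ℝ) :
    -- the successive flat extensions, hence the localizing matrices, are well defined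
    ((TruncatedMoment.momentMatrix n β).PosSemidef →
      ∀ β' : TruncatedMoment.TruncSeq d (2 * (n + 1)), TruncatedMoment.IsFlatExtension n β β' →
        ∃! γ : TruncatedMoment.FullSeq d, TruncatedMoment.IsFlatCompletion n β' γ) ∧
    -- the characterization
    ((∃ μ : MeasureTheory.Measure (Fin d → ℝ),
        TruncatedMoment.Represents μ β ∧
        TruncatedMoment.IsAtomicOfCard (TruncatedMoment.momentMatrix n β).rank μ ∧
        μ (TruncatedMoment.semialgebraicSet q)ᶜ = 0) ↔
      ((TruncatedMoment.momentMatrix n β).PosSemidef ∧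
        ∃ β' : TruncatedMoment.TruncSeq d (2 * (n + 1)), TruncatedMoment.IsFlatExtension n β β' ∧
          ∃ γ : TruncatedMoment.FullSeq d, TruncatedMoment.IsFlatCompletion n β' γ ∧
            ∀ i, (TruncatedMoment.localizingMatrix n (q i) γ).PosSemidef)) ∧
    -- uniqueness, minimality and the number of atoms, for every such flat extension
    ((TruncatedMoment.momentMatrix n β).PosSemidef →
      ∀ β' : TruncatedMoment.TruncSeq d (2 * (n + 1)), TruncatedMoment.IsFlatExtension n β β' →
        ∀ γ : TruncatedMoment.FullSeq d, TruncatedMoment.IsFlatCompletion n β' γ →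
          (∀ i, (TruncatedMoment.localizingMatrix n (q i) γ).PosSemidef) →
          ∃ μ : MeasureTheory.Measure (Fin d → ℝ),
            TruncatedMoment.Represents μ β' ∧
            (∀ ν : MeasureTheory.Measure (Fin d → ℝ),
              TruncatedMoment.Represents ν β' → ν = μ) ∧
            TruncatedMoment.Represents μ β ∧
            TruncatedMoment.IsAtomicOfCard (TruncatedMoment.momentMatrix n β).rank μ ∧
            μ (TruncatedMoment.semialgebraicSet q)ᶜ = 0 ∧
            (∀ (ν : MeasureTheory.Measure (Fin d → ℝ)) (k : ℕ),
              TruncatedMoment.Represents ν β → TruncatedMoment.IsAtomicOfCard k ν →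
                (TruncatedMoment.momentMatrix n β).rank ≤ k) ∧
            ∀ i, ((TruncatedMoment.atoms μ ∩ TruncatedMoment.zeroSet (q i)).ncard : ℤ) =
              ((TruncatedMoment.momentMatrix n β).rank : ℤ) -
                ((TruncatedMoment.localizingMatrix n (q i) γ).rank : ℤ)) := by
  refine ⟨fun hβ β' h => TruncatedMoment.existsUnique_isFlatCompletion hβ h, ⟨?_, ?_⟩, ?_⟩
  · rintro ⟨μ, hμ, hcard, hK⟩
    exact TruncatedMoment.exists_isFlatExtension_of_isAtomicOfCard hμ hcard hK
  · rintro ⟨hβ, β', h, γ, hγ, hq⟩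
    obtain ⟨μ, -, -, hμ, hcard, hK, -⟩ := TruncatedMoment.exists_representing_measure hβ h hγ hq
    exact ⟨μ, hμ, hcard, hK⟩
  · intro hβ β' h γ hγ hq
    obtain ⟨μ, h1, h2, h3, h4, h5, h6⟩ := TruncatedMoment.exists_representing_measure hβ h hγ hq
    exact ⟨μ, h1, h2, h3, h4, h5,
      fun ν k => TruncatedMoment.rank_momentMatrix_le_of_isAtomicOfCard, h6⟩
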